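/- Let $n\ge 0$ and let $\mathbb R\langle x_1,\dots,x_n\rangle$ be the real polynomials in non-commuting variables, with the linear involution $*$ that reverses words and fixes each $x_i$. A state is a unital linear functional $\varphi$ with $\varphi[A^*A]\ge 0$ for all $A$; it is faithful if $\varphi[A^*A]=0$ only for $A=0$, and tracial if $\varphi[ST]=\varphi[TS]$ for all $S,T$. For a unital functional $\varphi$ write $M(\mathbf w)=\sum_{|\vec u|\ge 1}\varphi[x_{\vec u}]\,w_{\vec u}$ (a formal power series in non-commuting indeterminates). Its free cumulant functional $R_\varphi$ is the linear functional with $R_\varphi[1]=0$ whose generating function $R(\mathbf z)=\sum_{|\vec u|\ge1}R_\varphi[x_{\vec u}]\,z_{\vec u}$ satisfies $R\bigl(w_1(1+M(\mathbf w)),\dots,w_n(1+M(\mathbf w))\bigr)=M(\mathbf w)$. Let $D_i$ be the left partial derivative, $D_i1=0$, $D_i(z_jz_{\vec u})=\delta_{ij}z_{\vec u}$. A state $\varphi$ is freely infinitely divisible if for every $t>0$ the unital functional with free cumulant functional $tR_\varphi$ is a state. A state $\varphi$ with $\varphi[x_i]=0$ and $\varphi[x_ix_j]=\delta_{ij}$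 is a free Meixner state if, with $R$ its free cumulant generating function and $U_i(\mathbf z)=z_i+\text{higher-order terms}$ determined by $(D_iR)(\mathbf U(\mathbf z))=z_i$, the polynomials $P_{\vec u}(\mathbf x)$ defined by $$1+\sum_{|\vec u|\ge1}P_{\vec u}(\mathbf x)z_{\vec u}=\bigl(1-\mathbf x\cdot\mathbf U(\mathbf z)+R(\mathbf U(\mathbf z))\bigr)^{-1}$$ (the $x_i$ commuting with the $z_j$) are orthogonal: with $P_\emptyset=1$, $\varphi[P_{\vec u}^*P_{\vec v}]=0$ whenever $\vec u\ne\vec v$. It has coefficients $B_{ij}^t$, $C_{ij}$ if $$D_iD_jR=\delta_{ij}+\sum_tB_{ij}^t\,D_tR+C_{ij}\,(D_iR)(D_jR)\qquad\text{for all } i,j.$$ **Proposition.** Let $b_i\in\mathbb R$ and $c_i\ge 0$ for $1\le i\le n$. There is a unique state $\psi$ (the joint law of a free semicircular system with means $b_i$ and variances $c_i$) with free cumulants $R_\psi[x_i]=b_i$, $R_\psi[x_i^2]=c_i$ and $R_\psi[x_{\vec u}]=0$ for all other words $\vec u$. There is a unique unital functional $\varphi$ with $R_\varphi=\exp(\psi\oplus\dots\oplus\psi)$,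 that is, with $$R_\varphi[1]=R_\varphi[x_i]=0,\qquad R_\varphi[x_iPx_j]=\delta_{ij}\,\psi[P]\quad\text{for all } P\in\mathbb R\langle\mathbf x\rangle .$$ This $\varphi$ is a faithful, freely infinitely divisible free Meixner state, with coefficients $B_{ij}^t=\delta_{jt}b_i$ and $C_{ij}=c_i$. If $n\ge2$ and $c_i\ne0$ for some $i$, then $\varphi$ is not tracial. -/

import Mathlib

/-! ### Non-commutative polynomials and functionals -/

/-- Real polynomials in `n` non-commuting variables `x_1, …, x_n`. The `star` operation provided by
Mathlib is the linear involution reversing words and fixing the variables. -/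
abbrev NCPoly (n : ℕ) : Type := FreeAlgebra ℝ (Fin n)

namespace NCPoly

variable {n : ℕ}

/-- The variable `x_i`. -/
noncomputable def x (i : Fin n) : NCPoly n := FreeAlgebra.ι ℝ i

/-- The monomial `x_u = x_{u(1)} ⋯ x_{u(k)}`; multi-indices are words (lists). -/
noncomputable def mono (u : List (Fin n)) : NCPoly n := (u.map x).prod

/-- The linear functional with prescribed values on the monomials. -/
noncomputable def ofCoeff (f : List (Fin n) → ℝ) : NCPoly n →ₗ[ℝ] ℝ :=
  (FreeAlgebra.basisFreeMonoid ℝ (Fin n)).constr ℝ fun w => f (FreeMonoid.toList w)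

theorem basis_eq_mono (w : FreeMonoid (Fin n)) :
    FreeAlgebra.basisFreeMonoid ℝ (Fin n) w = mono (FreeMonoid.toList w) := by
  simp [FreeAlgebra.basisFreeMonoid, FreeAlgebra.equivMonoidAlgebraFreeMonoid, mono,
    FreeMonoid.lift_apply]
  rfl

theorem ofCoeff_mono (f : List (Fin n) → ℝ) (u : List (Fin n)) : ofCoeff f (mono u) = f u := by
  have h := basis_eq_mono (FreeMonoid.ofList u)
  rw [FreeMonoid.toList_ofList] at h
  rw [← h, ofCoeff, Module.Basis.constr_basis, FreeMonoid.toList_ofList]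

/-- A state: a unital functional that is positive on all `A* A`. -/
def IsState (φ : NCPoly n →ₗ[ℝ] ℝ) : Prop :=
  φ 1 = 1 ∧ ∀ A : NCPoly n, 0 ≤ φ (star A * A)

/-- Faithfulness: `φ[A* A] = 0` only for `A = 0`. -/
def IsFaithful (φ : NCPoly n →ₗ[ℝ] ℝ) : Prop :=
  ∀ A : NCPoly n, φ (star A * A) = 0 → A = 0

def IsTracial (φ : NCPoly n →ₗ[ℝ] ℝ) : Prop :=
  ∀ S T : NCPoly n, φ (S * T) = φ (T * S)

/-- The variables are centered and have identity covariance. -/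
def IsNormalized (φ : NCPoly n →ₗ[ℝ] ℝ) : Prop :=
  (∀ i, φ (x i) = 0) ∧ ∀ i j, φ (x i * x j) = if i = j then 1 else 0

end NCPoly

/-! ### Formal power series in non-commuting variables -/

/-- Formal power series in non-commuting variables `z_1, …, z_n`, which commute with the
coefficients in `A`: a family of coefficients indexed by words. -/
def NCSeries (n : ℕ) (A : Type) : Type := List (Fin n) → A

namespace NCSeries

variable {n : ℕ} {A : Type}

@[ext] theorem ext {f g : NCSeries n A} (h : ∀ w, f w = g w) : f = g := funext h

/-- The left partial derivative: `D_i (z_j z_u) = δ_{ij} z_u`, `D_i 1 = 0`. -/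
def D (i : Fin n) (f : NCSeries n A) : NCSeries n A := fun w => f (i :: w)

section Ring

variable [Ring A]

instance : AddCommGroup (NCSeries n A) := inferInstanceAs (AddCommGroup (List (Fin n) → A))

/-- The power series `1`. -/
instance : One (NCSeries n A) := ⟨fun w => if w = [] then 1 else 0⟩

/-- The Cauchy product: the coefficient at `w` is the sum over all splittings `w = (u, v)`. -/
instance : Mul (NCSeries n A) :=
  ⟨fun f g w => ∑ k ∈ Finset.range (w.length + 1), f (w.take k) * g (w.drop k)⟩

theorem add_apply (f g : NCSeries n A) (w : List (Fin n)) : (f + g) w = f w + g w := rfl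

theorem zero_apply (w : List (Fin n)) : (0 : NCSeries n A) w = 0 := rfl

theorem one_apply (w : List (Fin n)) : (1 : NCSeries n A) w = if w = [] then 1 else 0 := rfl

theorem mul_apply (f g : NCSeries n A) (w : List (Fin n)) :
    (f * g) w = ∑ k ∈ Finset.range (w.length + 1), f (w.take k) * g (w.drop k) := rfl

theorem mul_nil (f g : NCSeries n A) : (f * g) [] = f [] * g [] := by
  simp [mul_apply]

theorem mul_cons (f g : NCSeries n A) (a : Fin n) (w : List (Fin n)) :
    (f * g) (a :: w) = f [] * g (a :: w) + (D a f * g) w := by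
  rw [mul_apply, List.length_cons, Finset.sum_range_succ']
  simp [mul_apply, D, add_comm]

theorem mul_assoc_apply (f g h : NCSeries n A) (w : List (Fin n)) :
    (f * g * h) w = (f * (g * h)) w := by
  induction w generalizing f g with
  | nil => simp [mul_nil, mul_assoc]
  | cons a w ih =>
    have key : (D a (f * g) * h) w = f [] * (D a g * h) w + (D a f * g * h) w := by
      have : ∀ v, D a (f * g) v = f [] * D a g v + (D a f * g) v := fun v => mul_cons f g a v
      simp only [mul_apply (D a (f * g)), this, add_mul, Finset.sum_add_distrib]
      rw [mul_apply (D a g) h, Finset.mul_sum, mul_apply (D a f * g) h]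
      simp only [mul_assoc]
    rw [mul_cons, mul_cons f, mul_cons g, key, ih, mul_nil, mul_add, mul_assoc, add_assoc]

instance : Ring (NCSeries n A) where
  __ := (inferInstance : AddCommGroup (NCSeries n A))
  one := 1
  mul := (· * ·)
  mul_assoc f g h := ext (mul_assoc_apply f g h)
  one_mul f := ext fun w => by
    cases w with
    | nil => simp [mul_nil, one_apply]
    | cons a w =>
      rw [mul_cons]
      simp [one_apply, mul_apply, D]
  mul_one f := ext fun w => by
    induction w generalizing f with
    | nil => simp [mul_nil, one_apply]
    | cons a w ih =>
      rw [mul_cons, ih]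
      simp [one_apply, D]
  left_distrib f g h := ext fun w => by
    simp [mul_apply, add_apply, mul_add, Finset.sum_add_distrib]
  right_distrib f g h := ext fun w => by
    simp [mul_apply, add_apply, add_mul, Finset.sum_add_distrib]
  zero_mul f := ext fun w => by simp [mul_apply, zero_apply]
  mul_zero f := ext fun w => by simp [mul_apply, zero_apply]

/-- The indeterminate `z_i`. -/
def z (i : Fin n) : NCSeries n A := fun w => if w = [i] then 1 else 0

/-- The constant power series `a`. -/
def const (a : A) : NCSeries n A := fun w => if w = [] then a else 0

/-- The substitution `f(V_1, …, V_n) = ∑_u f_u V_{u(1)} ⋯ V_{u(k)}`, for power series `V_i` without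
constant term. Then `V_{u(1)} ⋯ V_{u(k)}` has no terms of degree below `k`, so that only words `u`
with `k ≤ |w|` contribute to the coefficient at `w`. -/
def subst (f : NCSeries n A) (V : Fin n → NCSeries n A) : NCSeries n A := fun w =>
  ∑ k ∈ Finset.range (w.length + 1), ∑ u : Fin k → Fin n,
    f (List.ofFn u) * (List.ofFn fun l => V (u l)).prod w

end Ring

/-- A real power series regarded as one with coefficients in the non-commutative polynomials. -/
noncomputable def toPoly (f : NCSeries n ℝ) : NCSeries n (NCPoly n) :=
  fun w => algebraMap ℝ (NCPoly n) (f w)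

end NCSeries

namespace NCPoly

variable {n : ℕ}

/-! ### Free cumulants -/

/-- The generating function `∑_u f[x_u] z_u` (over all words, including the empty one) of a
functional `f`. For a unital functional `φ` this is `1 + M(z)`, with `M` the moment generating
function; for a cumulant functional, which vanishes at `1`, it is the cumulant generating
function. -/
noncomputable def genSeries (f : NCPoly n →ₗ[ℝ] ℝ) : NCSeries n ℝ := fun w => f (mono w)

/-- `R` is the free cumulant functional of `φ`: `R[1] = 0` and
`R(w_1 (1 + M(w)), …, w_n (1 + M(w))) = M(w)`. -/
def HasFreeCumulants (φ R : NCPoly n →ₗ[ℝ] ℝ) : Prop :=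
  R 1 = 0 ∧
    NCSeries.subst (genSeries R) (fun i => NCSeries.z i * genSeries φ) = genSeries φ - 1

/-- `φ` is a state and for all `t > 0` the functional `φ^t` with free cumulants `t R_φ` is a
state. -/
def IsFreelyInfinitelyDivisible (φ : NCPoly n →ₗ[ℝ] ℝ) : Prop :=
  IsState φ ∧ ∃ R, HasFreeCumulants φ R ∧
    ∀ t : ℝ, 0 < t → ∃ φt : NCPoly n →ₗ[ℝ] ℝ, IsState φt ∧ HasFreeCumulants φt (t • R)

/-! ### Free Sheffer polynomials and free Meixner states -/

/-- `U` is the compositional inverse of the gradient of `R`: `U_i = z_i + higher-order terms` and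
`(D_i R)(U(z)) = z_i`. -/
def IsGradientInverse (R : NCSeries n ℝ) (U : Fin n → NCSeries n ℝ) : Prop :=
  (∀ i, U i [] = 0) ∧ (∀ i j, U i [j] = if i = j then 1 else 0) ∧
    ∀ i, NCSeries.subst (NCSeries.D i R) U = NCSeries.z i

/-- `P` is the free Sheffer family with generating function
`∑_u P_u(x) z_u = (1 - x · U(z) + R(U(z)))⁻¹`. -/
def IsFreeSheffer (R : NCSeries n ℝ) (U : Fin n → NCSeries n ℝ)
    (P : List (Fin n) → NCPoly n) : Prop :=
  let G : NCSeries n (NCPoly n) :=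
    1 - ∑ i, NCSeries.const (x i) * (U i).toPoly + (NCSeries.subst R U).toPoly
  let H : NCSeries n (NCPoly n) := P
  G * H = 1 ∧ H * G = 1

/-- Orthogonality of a family indexed by all words, including the empty one. -/
def IsOrthogonalFamily (φ : NCPoly n →ₗ[ℝ] ℝ) (P : List (Fin n) → NCPoly n) : Prop :=
  ∀ u v, u ≠ v → φ (star (P u) * P v) = 0

/-- A free Meixner state: a state, with centered variables of identity covariance, whose free
Sheffer polynomials are orthogonal. -/
def IsFreeMeixner (φ : NCPoly n →ₗ[ℝ] ℝ) : Prop :=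
  IsState φ ∧ IsNormalized φ ∧
    ∃ R U P, HasFreeCumulants φ R ∧ IsGradientInverse (genSeries R) U ∧
      IsFreeSheffer (genSeries R) U P ∧ IsOrthogonalFamily φ P

/-- The coefficients of a free Meixner state: its free cumulant generating function satisfies
`D_i D_j R = δ_{ij} + ∑_t B^t_{ij} D_t R + C_{ij} (D_i R) (D_j R)`. Here `B i j t` is `B^t_{ij}`. -/
def HasMeixnerCoefficients (φ : NCPoly n →ₗ[ℝ] ℝ) (B : Fin n → Fin n → Fin n → ℝ)
    (C : Fin n → Fin n → ℝ) : Prop :=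
  ∃ R, HasFreeCumulants φ R ∧ ∀ i j,
    NCSeries.D i (NCSeries.D j (genSeries R)) =
      NCSeries.const (if i = j then 1 else 0)
        + ∑ t, NCSeries.const (B i j t) * NCSeries.D t (genSeries R)
        + NCSeries.const (C i j) * (NCSeries.D i (genSeries R) * NCSeries.D j (genSeries R))

/-! ### Free semicircular systems and the exponential -/

/-- Values on monomials of the free cumulant functional of a free semicircular system. -/
def semicircularCoeff (b c : Fin n → ℝ) : List (Fin n) → ℝ
  | [i] => b i
  | [i, j] => if i = j then c i else 0
  | _ => 0

/-- The joint law of a free semicircular system with means `b_i` and variances `c_i`: the state with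
`R[x_i] = b_i`, `R[x_i^2] = c_i`, and all other free cumulants equal to zero. -/
def IsFreeSemicircularLaw (b c : Fin n → ℝ) (ψ : NCPoly n →ₗ[ℝ] ℝ) : Prop :=
  IsState ψ ∧ HasFreeCumulants ψ (ofCoeff (semicircularCoeff b c))

/-- Values on monomials of `exp(ψ_1 ⊕ … ⊕ ψ_n)`. -/
noncomputable def expCoeff (ψ : Fin n → NCPoly n →ₗ[ℝ] ℝ) : List (Fin n) → ℝ
  | [] => 0
  | [_] => 0
  | i :: j :: u =>
    if i = (j :: u).getLast (List.cons_ne_nil j u) then ψ i (mono (j :: u).dropLast) else 0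

/-- The functional `exp(ψ_1 ⊕ … ⊕ ψ_n)`; see `expSum_one`, `expSum_x` and `expSum_mul` for its
defining properties. -/
noncomputable def expSum (ψ : Fin n → NCPoly n →ₗ[ℝ] ℝ) : NCPoly n →ₗ[ℝ] ℝ :=
  ofCoeff (expCoeff ψ)

theorem expSum_one (ψ : Fin n → NCPoly n →ₗ[ℝ] ℝ) : expSum ψ 1 = 0 := by
  have h := ofCoeff_mono (expCoeff ψ) []
  simpa [mono, expCoeff, expSum] using h

theorem expSum_x (ψ : Fin n → NCPoly n →ₗ[ℝ] ℝ) (i : Fin n) : expSum ψ (x i) = 0 := by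
  have h := ofCoeff_mono (expCoeff ψ) [i]
  simpa [mono, expCoeff, expSum] using h

theorem expCoeff_append (ψ : Fin n → NCPoly n →ₗ[ℝ] ℝ) (i j : Fin n) (u : List (Fin n)) :
    expCoeff ψ (i :: (u ++ [j])) = if i = j then ψ i (mono u) else 0 := by
  cases u with
  | nil => simp [expCoeff]
  | cons a u => simp [expCoeff, List.dropLast_cons_of_ne_nil]

theorem expSum_mul (ψ : Fin n → NCPoly n →ₗ[ℝ] ℝ) (i j : Fin n) (P : NCPoly n) :
    expSum ψ (x i * P * x j) = if i = j then ψ i P else 0 := by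
  have h : (expSum ψ) ∘ₗ (LinearMap.mulRight ℝ (x j)) ∘ₗ (LinearMap.mulLeft ℝ (x i)) =
      (if i = j then (1 : ℝ) else 0) • ψ i := by
    refine (FreeAlgebra.basisFreeMonoid ℝ (Fin n)).ext fun w => ?_
    have h1 := ofCoeff_mono (expCoeff ψ) (i :: (FreeMonoid.toList w ++ [j]))
    rw [expCoeff_append] at h1
    have h2 : mono (i :: (FreeMonoid.toList w ++ [j])) = x i * mono (FreeMonoid.toList w) * x j := by
      simp [mono, mul_assoc]
    rw [h2] at h1
    split_ifs at h1 ⊢ <;> simpa [basis_eq_mono, expSum] using h1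
  have h3 := LinearMap.congr_fun h P
  split_ifs at h3 ⊢ <;> simpa using h3

end NCPoly

/-! Write `m = 1 + M` for the moment series. Left differentiation turns the cumulant relation into
`D_i m = m · (D_i R)(z m)`. Such equations, together with a constant term, determine a series degree
by degree, so existence, uniqueness and identities between series all come from comparing equations
(`exists_D_eq`, `eq_of_D_eq`).

Let `Ψ` be the moment series of `ψ`. For `R = t exp(ψ ⊕ … ⊕ ψ)` one has `D_i R = t Ψ z_i`, hence
`D_i m = t Θ z_i m` with `Θ = m · Ψ(z m)`. This `Θ` solves the semicircular equation with means
`b_i` and variances `t + c_i` (`hasFreeCumulants_meixner`). By `genSeries_vacuum`, `m` is therefore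
the vacuum moment series of operators on the full Fock space, each the sum of a creation, a diagonal
and an annihilation part, with coefficients `0, t` at the vacuum and `b_i, t + c_i` elsewhere. These
operators are symmetric for a diagonal form with weights that are nonnegative for `t ≥ 0` and
positive for `t > 0`. This gives positivity for every `t`, faithfulness, and orthogonality of the
polynomials sending the vacuum to the basis vectors.

At `t = 1` these polynomials are the free Sheffer polynomials. With `F = 1 + ∑ (b_i z_i + c_i
z_i²)`, the inverse of the gradient is `U_i = F⁻¹ z_i`, because `Ψ(U) = F`; the three-term recursion
then inverts the Sheffer generating function. -/

namespace NCSeries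

variable {n : ℕ} {A : Type}

/-! ### Formal differential equations: comparison by degree -/

theorem ext_D {f g : NCSeries n A} (h₀ : f [] = g []) (h : ∀ i, D i f = D i g) : f = g := by
  ext w
  cases w with
  | nil => exact h₀
  | cons i w => exact congrFun (h i) w

/-- Two series have the same coefficients at the words of length less than `k`. -/
def AgreeBelow (k : ℕ) (f g : NCSeries n A) : Prop := ∀ w, w.length < k → f w = g w

namespace AgreeBelow

variable {k : ℕ} {f g : NCSeries n A}

theorem refl (k : ℕ) (f : NCSeries n A) : AgreeBelow k f f := fun _ _ => rfl

theorem symm (h : AgreeBelow k f g) : AgreeBelow k g f := fun w hw => (h w hw).symm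

theorem trans {e : NCSeries n A} (h : AgreeBelow k f g) (h' : AgreeBelow k g e) :
    AgreeBelow k f e :=
  fun w hw => (h w hw).trans (h' w hw)

theorem mono {l : ℕ} (hl : l ≤ k) (h : AgreeBelow k f g) : AgreeBelow l f g :=
  fun w hw => h w (hw.trans_le hl)

theorem succ (h₀ : f [] = g []) (h : ∀ i, AgreeBelow k (D i f) (D i g)) :
    AgreeBelow (k + 1) f g
  | [], _ => h₀
  | i :: w, hw => h i w (by simpa using hw)

theorem eq (h : ∀ k, AgreeBelow k f g) : f = g :=
  ext fun w => h (w.length + 1) w (Nat.lt_succ_self _)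

end AgreeBelow

/-- A formal differential equation `D_i f = Φ_i f` in which the coefficients of `Φ_i f` up to a
given degree depend only on those of `f` up to the same degree has at most one solution with given
constant term. -/
theorem eq_of_D_eq {Φ : Fin n → NCSeries n A → NCSeries n A}
    (hΦ : ∀ i k f g, AgreeBelow k f g → AgreeBelow k (Φ i f) (Φ i g)) {f g : NCSeries n A}
    (h₀ : f [] = g []) (hf : ∀ i, D i f = Φ i f) (hg : ∀ i, D i g = Φ i g) : f = g := by
  refine AgreeBelow.eq fun k => ?_
  induction k with
  | zero => exact fun w hw => absurd hw (Nat.not_lt_zero _)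
  | succ k ih => exact .succ h₀ fun i => by rw [hf, hg]; exact hΦ i k f g ih

/-! ### Rules for left derivatives, Picard iteration, inverses -/

section Ring

variable [Ring A]

theorem sub_apply (f g : NCSeries n A) (w : List (Fin n)) : (f - g) w = f w - g w := rfl

theorem sum_apply {ι : Type*} (s : Finset ι) (f : ι → NCSeries n A) (w : List (Fin n)) :
    (∑ i ∈ s, f i) w = ∑ i ∈ s, f i w :=
  map_sum (⟨⟨fun g => g w, rfl⟩, fun _ _ => rfl⟩ : NCSeries n A →+ A) f s

@[simp] theorem one_nil : (1 : NCSeries n A) [] = 1 := rfl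

@[simp] theorem const_nil (a : A) : (const a : NCSeries n A) [] = a := rfl

@[simp] theorem z_nil (i : Fin n) : (z i : NCSeries n A) [] = 0 := by simp [z]

@[simp] theorem D_add (i : Fin n) (f g : NCSeries n A) : D i (f + g) = D i f + D i g := rfl

@[simp] theorem D_sub (i : Fin n) (f g : NCSeries n A) : D i (f - g) = D i f - D i g := rfl

@[simp] theorem D_sum {ι : Type*} (i : Fin n) (s : Finset ι) (f : ι → NCSeries n A) :
    D i (∑ j ∈ s, f j) = ∑ j ∈ s, D i (f j) := by
  ext w
  simp only [D, sum_apply]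

@[simp] theorem D_const (i : Fin n) (a : A) : D i (const a) = 0 := by
  ext w
  simp [D, const, zero_apply]

@[simp] theorem D_one (i : Fin n) : D i (1 : NCSeries n A) = 0 := by
  ext w
  simp [D, one_apply, zero_apply]

@[simp] theorem D_z (i j : Fin n) : D i (z j : NCSeries n A) = if i = j then 1 else 0 := by
  ext w
  by_cases h : i = j <;> simp [D, z, one_apply, zero_apply, h]

@[simp] theorem const_mul_apply (a : A) (f : NCSeries n A) (w : List (Fin n)) :
    (const a * f : NCSeries n A) w = a * f w := by
  cases w with
  | nil => rw [mul_nil, const_nil]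
  | cons i w => rw [mul_cons, D_const, zero_mul]; simp [zero_apply]

theorem D_mul (i : Fin n) (f g : NCSeries n A) :
    D i (f * g) = const (f []) * D i g + D i f * g := by
  ext w
  rw [add_apply, const_mul_apply]
  exact mul_cons f g i w

@[simp] theorem const_zero : (const 0 : NCSeries n A) = 0 := by
  ext w
  simp [const, zero_apply]

@[simp] theorem const_one : (const 1 : NCSeries n A) = 1 := rfl

theorem const_add (a b : A) : (const (a + b) : NCSeries n A) = const a + const b := by
  ext w
  by_cases h : w = [] <;> simp [const, add_apply, h]

theorem const_mul (a b : A) : (const (a * b) : NCSeries n A) = const a * const b := by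
  ext w
  by_cases h : w = [] <;> simp [const, h]

theorem const_mul_comm {a : A} {f : NCSeries n A} (h : ∀ w, Commute (f w) a) :
    f * const a = const a * f := by
  ext w
  induction w generalizing f with
  | nil => rw [mul_nil, mul_nil]; exact (h []).eq
  | cons i w ih =>
    rw [mul_cons, ih (f := D i f) fun v => h (i :: v)]
    simp [const, D]

@[simp] theorem D_const_mul (i : Fin n) (a : A) (f : NCSeries n A) :
    D i (const a * f) = const a * D i f := by
  simp [D_mul]

theorem D_z_mul (i j : Fin n) (f : NCSeries n A) :
    D i (z j * f) = if i = j then f else 0 := by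
  rw [D_mul, D_z, z_nil]
  split_ifs <;> simp

theorem z_mul_nil (g : NCSeries n A) (i : Fin n) : (z i * g : NCSeries n A) [] = 0 := by
  simp [mul_nil]

theorem z_mul_cons (g : NCSeries n A) (i j : Fin n) (w : List (Fin n)) :
    (z i * g : NCSeries n A) (j :: w) = if i = j then g w else 0 := by
  by_cases h : i = j
  · subst h
    exact (congrFun (D_z_mul i i g) w).trans (by simp)
  · exact (congrFun (D_z_mul j i g) w).trans (by simp [h, eq_comm (a := j), zero_apply])

namespace AgreeBelow

variable {k : ℕ} {f f' g g' : NCSeries n A}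

theorem add (hf : AgreeBelow k f f') (hg : AgreeBelow k g g') :
    AgreeBelow k (f + g) (f' + g') :=
  fun w hw => by rw [add_apply, add_apply, hf w hw, hg w hw]

theorem sum {ι : Type*} (s : Finset ι) {f f' : ι → NCSeries n A}
    (h : ∀ i ∈ s, AgreeBelow k (f i) (f' i)) : AgreeBelow k (∑ i ∈ s, f i) (∑ i ∈ s, f' i) :=
  fun w hw => by
    rw [sum_apply, sum_apply]
    exact Finset.sum_congr rfl fun i hi => h i hi w hw

theorem mul (hf : AgreeBelow k f f') (hg : AgreeBelow k g g') :
    AgreeBelow k (f * g) (f' * g') :=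
  fun w hw => by
    rw [mul_apply, mul_apply]
    refine Finset.sum_congr rfl fun j _ => ?_
    rw [hf _ (by simp; omega), hg _ (by simp; omega)]

theorem mul_succ (h₀ : f [] = 0) (hg : AgreeBelow k g g') :
    AgreeBelow (k + 1) (f * g) (f * g') :=
  succ (by simp [mul_nil, h₀]) fun i => by
    simpa [D_mul, h₀] using (refl k (D i f)).mul hg

end AgreeBelow

/-- Picard iteration for `D_i f = Φ_i f` with constant term `a`. -/
def picard (a : A) (Φ : Fin n → NCSeries n A → NCSeries n A) : ℕ → NCSeries n A
  | 0 => const a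
  | k + 1 => fun w => match w with
    | [] => a
    | i :: w => Φ i (picard a Φ k) w

theorem exists_D_eq (a : A) {Φ : Fin n → NCSeries n A → NCSeries n A}
    (hΦ : ∀ i k f g, AgreeBelow k f g → AgreeBelow k (Φ i f) (Φ i g)) :
    ∃ f : NCSeries n A, f [] = a ∧ ∀ i, D i f = Φ i f := by
  have nil : ∀ k, picard a Φ k [] = a := fun k => by cases k <;> rfl
  have step : ∀ k, AgreeBelow (k + 1) (picard a Φ k) (picard a Φ (k + 1)) := by
    intro k
    induction k with
    | zero => exact .succ (by rw [nil, nil]) fun i w hw => absurd hw (Nat.not_lt_zero _)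
    | succ k ih => exact .succ (by rw [nil, nil]) fun i => hΦ i _ _ _ ih
  have steps : ∀ k l, AgreeBelow (k + 1) (picard a Φ k) (picard a Φ (k + l)) := by
    intro k l
    induction l with
    | zero => exact .refl _ _
    | succ l ih => exact ih.trans ((step (k + l)).mono (by omega))
  -- The limit takes its coefficient at `w` from stage `|w|`, where that coefficient is already
  -- stable.
  have lim : ∀ k, AgreeBelow (k + 1) (picard a Φ k) (fun w => picard a Φ w.length w) := by
    intro k w hw
    obtain ⟨l, rfl⟩ := Nat.exists_eq_add_of_le (Nat.lt_succ_iff.mp hw)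
    exact (steps w.length l w (Nat.lt_succ_self _)).symm
  exact ⟨fun w => picard a Φ w.length w, nil 0, fun i => ext fun w =>
    hΦ i _ _ _ (lim w.length) w (Nat.lt_succ_self _)⟩

theorem exists_mul_eq_one {f : NCSeries n A} (hf : f [] = 1) :
    ∃ g : NCSeries n A, g [] = 1 ∧ f * g = 1 ∧ g * f = 1 := by
  have right : ∀ f : NCSeries n A, f [] = 1 → ∃ g : NCSeries n A, g [] = 1 ∧ f * g = 1 := by
    intro f hf
    -- Since `f [] = 1`, this is the equation `D_i (f g) = 0` solved for `D_i g`.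
    obtain ⟨g, hg, hD⟩ := exists_D_eq (Φ := fun i g => -D i f * g) 1
      fun i k g g' h => (AgreeBelow.refl k _).mul h
    refine ⟨g, hg, ext_D (by simp [mul_nil, hf, hg]) fun i => ?_⟩
    simp [D_mul, hf, hD]
  obtain ⟨g, hg, hfg⟩ := right f hf
  obtain ⟨h, -, hgh⟩ := right g hg
  have : f = h := by rw [← mul_one f, ← hgh, ← mul_assoc, hfg, one_mul]
  exact ⟨g, hg, hfg, this ▸ hgh⟩

end Ring

/-! ### Substitution of series without constant term -/

section Subst

variable [CommRing A]

theorem mul_const (f : NCSeries n A) (a : A) : f * const a = const a * f :=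
  const_mul_comm fun _ => mul_comm _ _

theorem mul_const_mul (f g : NCSeries n A) (a : A) :
    f * (const a * g) = const a * (f * g) := by
  rw [← mul_assoc, mul_const, mul_assoc]

/-- The part of a substitution that comes from the words of length `k`. -/
def substHom (V : Fin n → NCSeries n A) : ℕ → NCSeries n A → NCSeries n A
  | 0, f => const (f [])
  | k + 1, f => ∑ i, V i * substHom V k (D i f)

theorem substHom_apply (V : Fin n → NCSeries n A) (k : ℕ) (f : NCSeries n A)
    (w : List (Fin n)) : substHom V k f w =
      ∑ u : Fin k → Fin n, f (List.ofFn u) * (List.ofFn fun l => V (u l)).prod w := by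
  induction k generalizing f w with
  | zero => simp [substHom, const, one_apply]
  | succ k ih =>
    have key : ∀ i, (V i * substHom V k (D i f)) w = ∑ u : Fin k → Fin n,
        f (i :: List.ofFn u) * (V i * (List.ofFn fun l => V (u l)).prod) w := by
      intro i
      simp only [mul_apply, ih, Finset.mul_sum, D]
      rw [Finset.sum_comm]
      exact Finset.sum_congr rfl fun _ _ => Finset.sum_congr rfl fun _ _ => by ring
    rw [substHom, sum_apply, Finset.sum_congr rfl fun i _ => key i,
      ← (Fin.consEquiv fun _ => Fin n).sum_comp, Fintype.sum_prod_type]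
    simp [Fin.consEquiv, List.ofFn_succ]

theorem substHom_agreeBelow {V : Fin n → NCSeries n A} (hV : ∀ i, V i [] = 0) (k : ℕ)
    (f : NCSeries n A) : AgreeBelow k (substHom V k f) 0 := by
  induction k generalizing f with
  | zero => exact fun w hw => absurd hw (Nat.not_lt_zero _)
  | succ k ih =>
    simpa [substHom] using AgreeBelow.sum Finset.univ fun i _ => (ih (D i f)).mul_succ (hV i)

/-- Words of length `k` contribute only in degree at least `k`, so the cutoff at `|w|` can be
replaced by any uniform larger one. -/
theorem subst_agreeBelow {V : Fin n → NCSeries n A} (hV : ∀ i, V i [] = 0) (N : ℕ)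
    (f : NCSeries n A) :
    AgreeBelow N (subst f V) (∑ k ∈ Finset.range N, substHom V k f) := by
  intro w hw
  rw [sum_apply, subst]
  simp only [← substHom_apply]
  refine Finset.sum_subset (by simpa using hw) fun k _ hk => ?_
  exact substHom_agreeBelow hV k f w (by simp at hk; omega)

/-- Grouping nonempty words by their first letter gives a recursion that no longer mentions the
cutoff; later facts about substitution rest on it. -/
theorem subst_eq {V : Fin n → NCSeries n A} (hV : ∀ i, V i [] = 0) (f : NCSeries n A) :
    subst f V = const (f []) + ∑ i, V i * subst (D i f) V := by
  refine AgreeBelow.eq fun N => ((subst_agreeBelow hV (N + 1) f).mono N.le_succ).trans ?_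
  rw [Finset.sum_range_succ']
  simp only [substHom]
  rw [add_comm, Finset.sum_comm]
  refine (AgreeBelow.refl _ _).add (.sum _ fun i _ => ?_)
  rw [← Finset.mul_sum]
  exact (AgreeBelow.refl _ _).mul (subst_agreeBelow hV N _).symm

theorem subst_nil (V : Fin n → NCSeries n A) (f : NCSeries n A) : subst f V [] = f [] := by
  simp [subst, one_apply]

theorem subst_add (V : Fin n → NCSeries n A) (f g : NCSeries n A) :
    subst (f + g) V = subst f V + subst g V := by
  ext w
  simp [subst, add_apply, add_mul, Finset.sum_add_distrib]

theorem subst_const_mul (V : Fin n → NCSeries n A) (a : A) (f : NCSeries n A) :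
    subst (const a * f) V = const a * subst f V := by
  ext w
  simp [subst, Finset.mul_sum, mul_assoc]

theorem subst_zero (V : Fin n → NCSeries n A) : subst 0 V = 0 := by
  ext w
  simp [subst, zero_apply]

section

variable {V : Fin n → NCSeries n A} (hV : ∀ i, V i [] = 0)
include hV

theorem subst_const (a : A) : subst (const a) V = const a := by
  rw [subst_eq hV]
  simp [subst_zero]

theorem subst_z (i : Fin n) : subst (z i) V = V i := by
  rw [subst_eq hV, Finset.sum_eq_single i]
  · rw [D_z, if_pos rfl, ← const_one, subst_const hV]
    simp
  · intro j _ hj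
    simp [hj, subst_zero]
  · simp

theorem subst_mul (f g : NCSeries n A) : subst (f * g) V = subst f V * subst g V := by
  refine AgreeBelow.eq fun k => ?_
  induction k generalizing f with
  | zero => exact fun w hw => absurd hw (Nat.not_lt_zero _)
  | succ k ih =>
    have h₁ : subst (f * g) V =
        const (f []) * subst g V + ∑ i, V i * subst (D i f * g) V := by
      rw [subst_eq hV (f * g), subst_eq hV g]
      simp only [D_mul, subst_add, subst_const_mul, mul_nil, const_mul, mul_add,
        Finset.sum_add_distrib, Finset.mul_sum, mul_const_mul, add_assoc]
    have h₂ : subst f V * subst g V =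
        const (f []) * subst g V + ∑ i, V i * (subst (D i f) V * subst g V) := by
      rw [subst_eq hV f, add_mul, Finset.sum_mul]
      simp only [mul_assoc]
    rw [h₁, h₂]
    -- The factor `V i` has no constant term, so agreement below `k` improves to agreement below `k
    -- + 1`.
    exact (AgreeBelow.refl _ _).add (.sum _ fun i _ => (ih (D i f)).mul_succ (hV i))

end

/-- Every word in `z j * g` begins with `j`, so `D i` selects a single summand of `subst_eq`. -/
theorem D_subst_z_mul (f g : NCSeries n A) (i : Fin n) :
    D i (subst f fun j => z j * g) = g * subst (D i f) fun j => z j * g := by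
  conv_lhs => rw [subst_eq (z_mul_nil g)]
  simp [mul_assoc, D_z_mul]

theorem subst_z_mul_agreeBelow {g g' : NCSeries n A} {k : ℕ} (h : AgreeBelow k g g')
    (f : NCSeries n A) :
    AgreeBelow k (subst f fun j => z j * g) (subst f fun j => z j * g') := by
  induction k generalizing f with
  | zero => exact fun w hw => absurd hw (Nat.not_lt_zero _)
  | succ k ih =>
    refine .succ (by simp [subst_nil]) fun i => ?_
    rw [D_subst_z_mul, D_subst_z_mul]
    exact (h.mono k.le_succ).mul (ih (h.mono k.le_succ) _)

end Subst

end NCSeries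

namespace NCPoly

variable {n : ℕ}

theorem mono_nil : mono ([] : List (Fin n)) = 1 := rfl

theorem mono_cons (i : Fin n) (u : List (Fin n)) : mono (i :: u) = x i * mono u := by
  simp [mono]

theorem star_x (i : Fin n) : star (x i) = x i := FreeAlgebra.star_ι i

theorem ext_mono {f g : NCPoly n →ₗ[ℝ] ℝ} (h : ∀ u, f (mono u) = g (mono u)) : f = g :=
  (FreeAlgebra.basisFreeMonoid ℝ (Fin n)).ext fun w => by
    rw [basis_eq_mono]
    exact h _

/-! ### Tree Jacobi operators on the full Fock space -/

namespace Fock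

variable (β γ : Fin n → List (Fin n) → ℝ)

/-- The annihilation part of a tree Jacobi operator: `e_{jv} ↦ δ_{ij} γ_i(v) e_v`. -/
noncomputable def lower (i : Fin n) : List (Fin n) → List (Fin n) →₀ ℝ
  | [] => 0
  | j :: v => if i = j then γ i v • Finsupp.single v 1 else 0

/-- The operator `e_u ↦ e_{iu} + β_i(u) e_u + [u = iv] γ_i(v) e_v` on the algebraic full Fock
space, whose basis `e_u` is indexed by words. -/
noncomputable def op (i : Fin n) : (List (Fin n) →₀ ℝ) →ₗ[ℝ] (List (Fin n) →₀ ℝ) :=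
  Finsupp.linearCombination ℝ fun u =>
    Finsupp.single (i :: u) 1 + β i u • Finsupp.single u 1 + lower γ i u

/-- The squared norms of the basis vectors which make the operators `op` symmetric. -/
def weight : List (Fin n) → ℝ
  | [] => 1
  | i :: v => γ i v * weight v

/-- The bilinear form for which the basis vectors are orthogonal with squared norms `weight`. -/
noncomputable def form : (List (Fin n) →₀ ℝ) →ₗ[ℝ] (List (Fin n) →₀ ℝ) →ₗ[ℝ] ℝ :=
  Finsupp.linearCombination ℝ fun u => weight γ u • Finsupp.lapply u

/-- The representation of polynomials by the operators `op`. -/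
noncomputable def rep : NCPoly n →ₐ[ℝ] Module.End ℝ (List (Fin n) →₀ ℝ) :=
  FreeAlgebra.lift ℝ (op β γ)

/-- The vacuum functional. -/
noncomputable def vacuum : NCPoly n →ₗ[ℝ] ℝ :=
  Finsupp.lapply [] ∘ₗ LinearMap.applyₗ (Finsupp.single [] 1) ∘ₗ (rep β γ).toLinearMap

/-- The polynomials which carry the vacuum vector to the basis vectors. -/
noncomputable def poly : List (Fin n) → NCPoly n
  | [] => 1
  | [i] => x i - algebraMap ℝ _ (β i [])
  | i :: j :: v => (x i - algebraMap ℝ _ (β i (j :: v))) * poly (j :: v) -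
      if i = j then γ i v • poly v else 0

theorem op_single (i : Fin n) (u : List (Fin n)) : op β γ i (Finsupp.single u 1) =
    Finsupp.single (i :: u) 1 + β i u • Finsupp.single u 1 + lower γ i u := by
  simp [op]

theorem form_single_left (u : List (Fin n)) (f : List (Fin n) →₀ ℝ) :
    form γ (Finsupp.single u 1) f = weight γ u * f u := by
  simp [form]

theorem form_apply (f g : List (Fin n) →₀ ℝ) :
    form γ f g = ∑ u ∈ f.support, f u * (weight γ u * g u) := by
  simp [form, Finsupp.linearCombination_apply, Finsupp.sum]

theorem op_nil (i : Fin n) (f : List (Fin n) →₀ ℝ) :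
    op β γ i f [] = β i [] * f [] + γ i [] * f [i] := by
  induction f using Finsupp.induction_linear with
  | zero => simp
  | add f g hf hg => rw [map_add, Finsupp.add_apply, hf, hg]; simp; ring
  | single u a =>
    rw [← Finsupp.smul_single_one u a, map_smul, op_single]
    rcases u with _ | ⟨j, v⟩
    · simp [lower]; ring
    · by_cases h : i = j
      · subst h; simp [lower, Finsupp.single_apply]; grind
      · simp [lower, h]

theorem op_cons (i j : Fin n) (v : List (Fin n)) (f : List (Fin n) →₀ ℝ) :
    op β γ i f (j :: v) = (if i = j then f v else 0) + β i (j :: v) * f (j :: v) +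
      γ i (j :: v) * f (i :: j :: v) := by
  induction f using Finsupp.induction_linear with
  | zero => simp
  | add f g hf hg => rw [map_add, Finsupp.add_apply, hf, hg]; split_ifs <;> simp <;> ring
  | single u a =>
    rw [← Finsupp.smul_single_one u a, map_smul, op_single]
    rcases u with _ | ⟨l, u⟩
    · by_cases h : i = j <;> simp [lower, Finsupp.single_apply, h]
    · rw [lower, Finsupp.smul_apply, Finsupp.add_apply, Finsupp.add_apply, Finsupp.smul_apply]
      have h₁ : (if i = l then γ i u • Finsupp.single u (1 : ℝ) else 0) (j :: v) =
          if i = l ∧ u = j :: v then γ i u else 0 := by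
        by_cases h : i = l <;> simp [h, Finsupp.single_apply]
      simp only [h₁, Finsupp.smul_apply, Finsupp.single_apply, smul_eq_mul]
      grind

/-- Creation and annihilation by the same letter are mutually adjoint because `weight (i :: v) = γ i
v * weight v`; the diagonal part is symmetric. -/
theorem form_op (i : Fin n) (f g : List (Fin n) →₀ ℝ) :
    form γ (op β γ i f) g = form γ f (op β γ i g) := by
  induction f using Finsupp.induction_linear with
  | zero => simp
  | add f f' hf hf' => simp [hf, hf']
  | single u a =>
    rw [← Finsupp.smul_single_one u a]
    simp only [map_smul, LinearMap.smul_apply, form_single_left, op_single, map_add,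
      LinearMap.add_apply, smul_eq_mul]
    congr 1
    rcases u with _ | ⟨j, v⟩
    · simp [lower, op_nil, weight]; ring
    · rw [op_cons]
      by_cases h : i = j
      · subst h; simp [lower, form_single_left, weight, -Finsupp.smul_single]; ring
      · simp [lower, h, weight]; ring

theorem rep_x (i : Fin n) : rep β γ (x i) = op β γ i := by
  simp [rep, x]

theorem form_rep (P : NCPoly n) (f g : List (Fin n) →₀ ℝ) :
    form γ (rep β γ P f) g = form γ f (rep β γ (star P) g) := by
  induction P using FreeAlgebra.induction generalizing f g with
  | grade0 r => simp
  | grade1 i =>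
    change form γ (rep β γ (x i) f) g = form γ f (rep β γ (star (x i)) g)
    rw [star_x, rep_x, form_op]
  | mul P Q hP hQ => simp [hP, hQ]
  | add P Q hP hQ => simp [hP, hQ]

theorem vacuum_apply (P : NCPoly n) :
    vacuum β γ P = rep β γ P (Finsupp.single [] 1) [] := rfl

theorem vacuum_one : vacuum β γ (1 : NCPoly n) = 1 := by
  simp [vacuum_apply]

theorem vacuum_star_mul (P Q : NCPoly n) : vacuum β γ (star P * Q) =
    form γ (rep β γ P (Finsupp.single [] 1)) (rep β γ Q (Finsupp.single [] 1)) := by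
  rw [form_rep, form_single_left, vacuum_apply, map_mul, Module.End.mul_apply]
  simp [weight]

variable {γ}

theorem weight_nonneg (hγ : ∀ i u, 0 ≤ γ i u) (u : List (Fin n)) : 0 ≤ weight γ u := by
  induction u with
  | nil => exact zero_le_one
  | cons i v ih => exact mul_nonneg (hγ i v) ih

theorem weight_pos (hγ : ∀ i u, 0 < γ i u) (u : List (Fin n)) : 0 < weight γ u := by
  induction u with
  | nil => exact zero_lt_one
  | cons i v ih => exact mul_pos (hγ i v) ih

theorem vacuum_isState (hγ : ∀ i u, 0 ≤ γ i u) : IsState (vacuum β γ) := by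
  refine ⟨vacuum_one β γ, fun P => ?_⟩
  rw [vacuum_star_mul, form_apply]
  refine Finset.sum_nonneg fun u _ => ?_
  nlinarith [weight_nonneg hγ u, mul_nonneg (weight_nonneg hγ u)
    (mul_self_nonneg (rep β γ P (Finsupp.single [] 1) u))]

variable (γ)

theorem x_mul_poly (i : Fin n) (u : List (Fin n)) : x i * poly β γ u =
    Finsupp.linearCombination ℝ (poly β γ) (op β γ i (Finsupp.single u 1)) := by
  rw [op_single]
  rcases u with _ | ⟨j, v⟩
  · simp [lower, poly, Algebra.smul_def]
  · by_cases h : i = j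
    · simp [lower, poly, h, Algebra.smul_def, sub_mul]
      abel
    · simp [lower, poly, h, Algebra.smul_def, sub_mul]

/-- The map sending `e_u` to `poly u` intertwines the representation with left multiplication. Hence
it recovers a polynomial from its action on the vacuum. -/
theorem mul_linearCombination_poly (P : NCPoly n) (f : List (Fin n) →₀ ℝ) :
    P * Finsupp.linearCombination ℝ (poly β γ) f =
      Finsupp.linearCombination ℝ (poly β γ) (rep β γ P f) := by
  induction P using FreeAlgebra.induction generalizing f with
  | grade0 r => simp [Algebra.smul_def]
  | grade1 i =>
    change x i * _ = Finsupp.linearCombination ℝ (poly β γ) (rep β γ (x i) f)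
    rw [rep_x]
    induction f using Finsupp.induction_linear with
    | zero => simp
    | add f g hf hg => simp [mul_add, hf, hg]
    | single u a =>
      rw [← Finsupp.smul_single_one u a]
      simp only [map_smul, mul_smul_comm, x_mul_poly, Finsupp.linearCombination_single, one_smul]
  | mul P Q hP hQ => simp [← hP, ← hQ, mul_assoc]
  | add P Q hP hQ => simp [hP, hQ, add_mul]

theorem linearCombination_poly_rep (P : NCPoly n) :
    Finsupp.linearCombination ℝ (poly β γ) (rep β γ P (Finsupp.single [] 1)) = P := by
  rw [← mul_linearCombination_poly]
  simp [poly]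

theorem rep_poly (u : List (Fin n)) :
    rep β γ (poly β γ u) (Finsupp.single [] 1) = Finsupp.single u 1 := by
  induction h : u.length using Nat.strong_induction_on generalizing u with
  | _ k ih =>
    subst h
    match u with
    | [] => simp [poly]
    | [i] => simp [poly, rep_x, op_single, lower, Algebra.algebraMap_eq_smul_one]
    | i :: j :: v =>
      have h₁ := ih _ (by simp) (j :: v) rfl
      have h₂ := ih v.length (by simp) v rfl
      by_cases h : i = j
      · simp [poly, rep_x, h, h₁, h₂, op_single, lower]
        abel
      · simp [poly, rep_x, h, h₁, op_single, lower]

theorem vacuum_star_poly_mul_poly {u v : List (Fin n)} (h : u ≠ v) :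
    vacuum β γ (star (poly β γ u) * poly β γ v) = 0 := by
  rw [vacuum_star_mul, rep_poly, rep_poly, form_single_left]
  simp [h]

variable {γ}

/-- With positive weights the form is definite, so a null polynomial annihilates the vacuum; a
polynomial is determined by its value on the vacuum. -/
theorem vacuum_isFaithful (hγ : ∀ i u, 0 < γ i u) : IsFaithful (vacuum β γ) := by
  intro P hP
  rw [vacuum_star_mul, form_apply, Finset.sum_eq_zero_iff_of_nonneg] at hP
  · have : rep β γ P (Finsupp.single [] 1) = 0 := by
      ext u
      by_contra hu
      have := hP u (by simpa using hu)
      simp_all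
      exact (weight_pos hγ u).ne' (hP u hu)
    rw [← linearCombination_poly_rep β γ P, this, map_zero]
  · intro u _
    nlinarith [mul_nonneg (weight_pos hγ u).le
      (mul_self_nonneg (rep β γ P (Finsupp.single [] 1) u))]

end Fock

end NCPoly

/-! ### Right multiplication by a variable, polynomial coefficients, the series to be realized -/

namespace NCSeries

variable {n : ℕ} {A : Type}

theorem mul_z_append [Ring A] (f : NCSeries n A) (i j : Fin n) (u : List (Fin n)) :
    (f * z i : NCSeries n A) (u ++ [j]) = if i = j then f u else 0 := by
  induction u generalizing f with
  | nil => by_cases h : i = j <;> simp [mul_cons, mul_nil, z, h, eq_comm (a := j)]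
  | cons k u ih =>
    rw [List.cons_append, mul_cons, ih]
    simp [z, D]

theorem mul_z_nil [Ring A] (f : NCSeries n A) (i : Fin n) : (f * z i : NCSeries n A) [] = 0 := by
  simp [mul_nil]

section ToPoly

variable (f g : NCSeries n ℝ)

@[simp] theorem toPoly_nil : f.toPoly [] = algebraMap ℝ _ (f []) := rfl

@[simp] theorem D_toPoly (i : Fin n) : D i f.toPoly = (D i f).toPoly := rfl

@[simp] theorem toPoly_add : (f + g).toPoly = f.toPoly + g.toPoly :=
  ext fun _ => map_add _ _ _

@[simp] theorem toPoly_const (a : ℝ) :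
    (const a : NCSeries n ℝ).toPoly = const (algebraMap ℝ _ a) := by
  ext w
  by_cases h : w = [] <;> simp [toPoly, const, h]

@[simp] theorem toPoly_one : (1 : NCSeries n ℝ).toPoly = 1 := by
  simpa using toPoly_const (n := n) 1

@[simp] theorem toPoly_z (i : Fin n) : (z i : NCSeries n ℝ).toPoly = z i := by
  ext w
  by_cases h : w = [i] <;> simp [toPoly, z, h]

@[simp] theorem toPoly_mul : (f * g).toPoly = f.toPoly * g.toPoly :=
  ext fun _ => by simp [toPoly, mul_apply]

@[simp] theorem toPoly_sum {ι : Type*} (s : Finset ι) (f : ι → NCSeries n ℝ) :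
    (∑ i ∈ s, f i).toPoly = ∑ i ∈ s, (f i).toPoly :=
  ext fun _ => by simp [toPoly, sum_apply]

theorem toPoly_mul_const (P : NCPoly n) : f.toPoly * const P = const P * f.toPoly :=
  const_mul_comm fun w => Algebra.commutes (f w) P

end ToPoly

/-- The differential equation `D_i Θ = b_i Θ + c_i Θ z_i Θ` of the moment generating function of a
free semicircular system with means `b_i` and variances `c_i`. -/
def IsSemicircularSeries (b c : Fin n → ℝ) (Θ : NCSeries n ℝ) : Prop :=
  Θ [] = 1 ∧ ∀ i, D i Θ = const (b i) * Θ + const (c i) * (Θ * (z i * Θ))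

theorem exists_isSemicircularSeries (b c : Fin n → ℝ) : ∃ Θ, IsSemicircularSeries b c Θ :=
  exists_D_eq 1 fun _ _ _ _ h => ((AgreeBelow.refl _ _).mul h).add
    ((AgreeBelow.refl _ _).mul (h.mul ((AgreeBelow.refl _ _).mul h)))

theorem exists_D_eq_const_mul (t : ℝ) (Θ : NCSeries n ℝ) :
    ∃ M : NCSeries n ℝ, M [] = 1 ∧ ∀ i, D i M = const t * (Θ * (z i * M)) :=
  exists_D_eq 1 fun _ _ _ _ h =>
    (AgreeBelow.refl _ _).mul ((AgreeBelow.refl _ _).mul ((AgreeBelow.refl _ _).mul h))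

end NCSeries

namespace NCPoly

open NCSeries

variable {n : ℕ}

/-! ### Functionals and their free cumulants -/

theorem genSeries_nil (f : NCPoly n →ₗ[ℝ] ℝ) : genSeries f [] = f 1 := rfl

theorem genSeries_injective : Function.Injective (genSeries (n := n)) :=
  fun _ _ h => ext_mono fun u => congrFun h u

theorem genSeries_ofCoeff (f : List (Fin n) → ℝ) : genSeries (ofCoeff f) = f :=
  funext fun u => ofCoeff_mono f u

theorem genSeries_smul (t : ℝ) (f : NCPoly n →ₗ[ℝ] ℝ) :
    genSeries (t • f) = const t * genSeries f :=
  NCSeries.ext fun w => by rw [const_mul_apply]; rfl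

/-- This is the left derivative of the defining relation; the constant terms on both sides vanish,
so nothing is lost. -/
theorem hasFreeCumulants_iff {φ R : NCPoly n →ₗ[ℝ] ℝ} (hφ : φ 1 = 1) (hR : R 1 = 0) :
    HasFreeCumulants φ R ↔ ∀ i, D i (genSeries φ) =
      genSeries φ * subst (D i (genSeries R)) fun j => z j * genSeries φ := by
  constructor
  · rintro ⟨-, h⟩ i
    have := congrArg (D i) h
    rwa [D_subst_z_mul, D_sub, D_one, sub_zero, eq_comm] at this
  · intro h
    refine ⟨hR, ext_D ?_ fun i => ?_⟩
    · rw [subst_nil, NCSeries.sub_apply, genSeries_nil, genSeries_nil, hφ, hR, one_nil, sub_self]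
    · rw [D_subst_z_mul, D_sub, D_one, sub_zero, h]

theorem HasFreeCumulants.unique {φ φ' R : NCPoly n →ₗ[ℝ] ℝ} (hφ : φ 1 = 1) (hφ' : φ' 1 = 1)
    (h : HasFreeCumulants φ R) (h' : HasFreeCumulants φ' R) : φ = φ' := by
  refine genSeries_injective (eq_of_D_eq
    (Φ := fun i m => m * subst (D i (genSeries R)) fun j => z j * m)
    (fun i k f g hfg => hfg.mul (subst_z_mul_agreeBelow hfg _)) (hφ.trans hφ'.symm) ?_ ?_)
  · exact (hasFreeCumulants_iff hφ h.1).1 h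
  · exact (hasFreeCumulants_iff hφ' h.1).1 h'

theorem D_semicircularCoeff (b c : Fin n → ℝ) (i : Fin n) :
    D i (semicircularCoeff b c : NCSeries n ℝ) = const (b i) + const (c i) * z i := by
  ext w
  rw [NCSeries.add_apply, const_mul_apply]
  match w with
  | [] => simp [D, semicircularCoeff]
  | [j] => by_cases h : i = j <;> simp [D, semicircularCoeff, const, z, h, eq_comm (a := j)]
  | j :: k :: w => simp [D, semicircularCoeff, const, z]

theorem hasFreeCumulants_semicircular_iff {b c : Fin n → ℝ} {ψ : NCPoly n →ₗ[ℝ] ℝ}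
    (hψ : ψ 1 = 1) : HasFreeCumulants ψ (ofCoeff (semicircularCoeff b c)) ↔
      IsSemicircularSeries b c (genSeries ψ) := by
  have h₀ : ofCoeff (semicircularCoeff b c) 1 = 0 := ofCoeff_mono _ []
  rw [hasFreeCumulants_iff hψ h₀, IsSemicircularSeries, genSeries_nil,
    and_iff_right hψ, genSeries_ofCoeff]
  refine forall_congr' fun i => ?_
  rw [D_semicircularCoeff, subst_add, subst_const_mul, subst_const (z_mul_nil _),
    subst_z (z_mul_nil _), mul_add, mul_const_mul, mul_const]

theorem D_expSum (ψ : NCPoly n →ₗ[ℝ] ℝ) (i : Fin n) :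
    D i (genSeries (expSum fun _ => ψ)) = genSeries ψ * z i := by
  rw [expSum, genSeries_ofCoeff]
  ext w
  rcases List.eq_nil_or_concat w with rfl | ⟨u, j, rfl⟩
  · simp [mul_z_nil, D, expCoeff]
  · rw [List.concat_eq_append, mul_z_append]
    exact expCoeff_append _ i j u

/-! ### Moments of vacuum states -/

/-- Coefficients on the full Fock space which distinguish only between the vacuum and the other
basis vectors. -/
def twoLevel (a₀ a : Fin n → ℝ) : Fin n → List (Fin n) → ℝ
  | i, [] => a₀ i
  | i, _ :: _ => a i

/-- `T u` collects, over all words `w`, the coefficient of `e_u` in `x_w` applied to the vacuum.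
Stripping the first letter of `w` removes the operator applied last, so the matrix entries of `op`
become a differential system for `T`. -/
theorem rep_mono_apply {β γ : Fin n → List (Fin n) → ℝ} {T : List (Fin n) → NCSeries n ℝ}
    (h₀ : ∀ u, T u [] = if u = [] then 1 else 0)
    (hnil : ∀ i, D i (T []) = const (β i []) * T [] + const (γ i []) * T [i])
    (hcons : ∀ i j v, D i (T (j :: v)) = (if i = j then T v else 0) +
      const (β i (j :: v)) * T (j :: v) + const (γ i (j :: v)) * T (i :: j :: v))
    (w u : List (Fin n)) :
    Fock.rep β γ (mono w) (Finsupp.single [] 1) u = T u w := by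
  induction w generalizing u with
  | nil => simp [mono_nil, h₀, Finsupp.single_apply, eq_comm]
  | cons i w ih =>
    rw [mono_cons, map_mul, Fock.rep_x, Module.End.mul_apply]
    change _ = D i (T u) w
    rcases u with _ | ⟨j, v⟩
    · rw [Fock.op_nil, ih, ih, hnil, NCSeries.add_apply, const_mul_apply, const_mul_apply]
    · rw [Fock.op_cons, ih, ih, ih, hcons, NCSeries.add_apply, NCSeries.add_apply,
        const_mul_apply, const_mul_apply]
      split_ifs <;> rfl

theorem genSeries_vacuum {β₀ γ₀ b c : Fin n → ℝ} {Θ M : NCSeries n ℝ}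
    (hΘ : IsSemicircularSeries b c Θ) (hM₀ : M [] = 1)
    (hM : ∀ i, D i M = const (β₀ i) * M + const (γ₀ i) * (Θ * (z i * M))) :
    genSeries (Fock.vacuum (twoLevel β₀ b) (twoLevel γ₀ c)) = M := by
  -- For `u = j₁ ⋯ j_k` this is `Θ z_{j₁} Θ z_{j₂} ⋯ Θ z_{j_k} M`: each factor `Θ` counts the
  -- excursions above a level before the next descent, and `M` those from the vacuum.
  let T : List (Fin n) → NCSeries n ℝ := fun u => u.foldr (fun j f => Θ * (z j * f)) M
  refine NCSeries.ext fun w => rep_mono_apply (T := T) (fun u => ?_) (fun i => ?_)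
    (fun i j v => ?_) w []
  · cases u <;> simp [T, mul_nil, hM₀]
  · exact hM i
  · change D i (Θ * (z j * T v)) = _ + const (b i) * (Θ * (z j * T v)) +
      const (c i) * (Θ * (z i * (Θ * (z j * T v))))
    rw [D_mul, D_z_mul, hΘ.1, hΘ.2, const_one, one_mul]
    simp only [add_mul, mul_assoc, add_assoc]

theorem exists_isFreeSemicircularLaw (b c : Fin n → ℝ) (hc : ∀ i, 0 ≤ c i) :
    ∃ ψ, IsFreeSemicircularLaw b c ψ := by
  obtain ⟨Θ, hΘ⟩ := exists_isSemicircularSeries b c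
  refine ⟨Fock.vacuum (twoLevel b b) (twoLevel c c),
    Fock.vacuum_isState _ fun i u => ?_, ?_⟩
  · cases u <;> exact hc i
  · rw [hasFreeCumulants_semicircular_iff (Fock.vacuum_one _ _),
      genSeries_vacuum hΘ hΘ.1 hΘ.2]
    exact hΘ

/-- The functional with free cumulants `t • exp(ψ ⊕ … ⊕ ψ)`, where `ψ` is the joint law of a free
semicircular system with means `b_i` and variances `c_i`. -/
noncomputable def meixner (b c : Fin n → ℝ) (t : ℝ) : NCPoly n →ₗ[ℝ] ℝ :=
  Fock.vacuum (twoLevel 0 b) (twoLevel (fun _ => t) fun i => t + c i)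

theorem hasFreeCumulants_meixner {b c : Fin n → ℝ} {ψ : NCPoly n →ₗ[ℝ] ℝ}
    (hψ : IsSemicircularSeries b c (genSeries ψ)) (t : ℝ) :
    HasFreeCumulants (meixner b c t) (t • expSum fun _ => ψ) := by
  obtain ⟨Θ, hΘ⟩ := exists_isSemicircularSeries b fun i => t + c i
  obtain ⟨M, hM₀, hM⟩ := exists_D_eq_const_mul t Θ
  have hgen : genSeries (meixner b c t) = M :=
    genSeries_vacuum hΘ hM₀ fun i => by rw [hM]; simp
  have hV := z_mul_nil M
  set K := subst (genSeries ψ) fun j => z j * M with hK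
  have hK₀ : K [] = 1 := by rw [hK, subst_nil, hψ.1]
  have hDK : ∀ i, D i K =
      const (b i) * (M * K) + const (c i) * (M * (K * (z i * (M * K)))) := by
    intro i
    rw [hK, D_subst_z_mul, hψ.2, subst_add, subst_const_mul, subst_const_mul, subst_mul hV,
      subst_mul hV, subst_z hV, mul_add, mul_const_mul, mul_const_mul, mul_assoc]
  -- Both sides solve the same equation, with `Θ` kept as a fixed coefficient in the term with `t`.
  -- For `Θ` this splits the variance `t + c i`; for `M * K` that term comes from `D i M`.
  have hMK : M * K = Θ := by
    refine eq_of_D_eq (Φ := fun i Y => const (b i) * Y + const (c i) * (Y * (z i * Y)) +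
      const t * (Θ * (z i * Y))) (fun i k f g h => ?_) ?_ (fun i => ?_) fun i => ?_
    · exact (((AgreeBelow.refl _ _).mul h).add
        ((AgreeBelow.refl _ _).mul (h.mul ((AgreeBelow.refl _ _).mul h)))).add
        ((AgreeBelow.refl _ _).mul ((AgreeBelow.refl _ _).mul ((AgreeBelow.refl _ _).mul h)))
    · rw [mul_nil, hM₀, hK₀, hΘ.1, one_mul]
    · rw [D_mul, hM₀, hDK, hM, const_one, one_mul]
      simp only [mul_assoc]
    · rw [hΘ.2, const_add, add_mul]
      abel
  have h₁ : meixner b c t 1 = 1 := Fock.vacuum_one _ _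
  rw [hasFreeCumulants_iff h₁ (by simp [expSum_one]), hgen]
  intro i
  rw [genSeries_smul, D_const_mul, D_expSum, subst_const_mul, subst_mul hV, subst_z hV, ← hK,
    mul_const_mul, ← mul_assoc M, hMK, hM]

/-! ### Positivity, normalization, non-traciality, coefficients -/

theorem meixner_isState {b c : Fin n → ℝ} (hc : ∀ i, 0 ≤ c i) {t : ℝ} (ht : 0 ≤ t) :
    IsState (meixner b c t) :=
  Fock.vacuum_isState _ fun i u => by
    cases u
    · exact ht
    · exact add_nonneg ht (hc i)

theorem meixner_isFaithful {b c : Fin n → ℝ} (hc : ∀ i, 0 ≤ c i) {t : ℝ} (ht : 0 < t) :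
    IsFaithful (meixner b c t) :=
  Fock.vacuum_isFaithful _ fun i u => by
    cases u
    · exact ht
    · exact add_pos_of_pos_of_nonneg ht (hc i)

theorem meixner_isNormalized (b c : Fin n → ℝ) : IsNormalized (meixner b c 1) := by
  refine ⟨fun i => ?_, fun i j => ?_⟩
  · rw [meixner, Fock.vacuum_apply, Fock.rep_x, Fock.op_nil]
    simp [twoLevel]
  · rw [meixner, Fock.vacuum_apply, map_mul, Module.End.mul_apply, Fock.rep_x, Fock.rep_x,
      Fock.op_nil, Fock.op_cons]
    by_cases h : i = j <;> simp [twoLevel, h, eq_comm (a := j)]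

theorem meixner_not_isTracial {b c : Fin n → ℝ} (hc : ∀ i, 0 ≤ c i) (hn : 2 ≤ n)
    (hi : ∃ i, c i ≠ 0) : ¬ IsTracial (meixner b c 1) := by
  intro h
  obtain ⟨i, hi⟩ := hi
  have : Nontrivial (Fin n) := Fin.nontrivial_iff_two_le.2 hn
  obtain ⟨j, hj⟩ := exists_ne i
  -- The left side is `φ[x_j x_i x_i x_j] = 1 + c_i + b_i²`, while the right side is `φ[x_i x_i x_j
  -- x_j] = 1`.
  have := h (x j) (x i * (x i * x j))
  simp [meixner, Fock.vacuum_apply, Fock.rep_x, Fock.op_nil, Fock.op_cons, twoLevel, hj,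
    hj.symm] at this
  have := (hc i).lt_of_ne' hi
  nlinarith [mul_self_nonneg (b i)]

/-- Differentiating `D_j R = Ψ z_j` once more gives `δ_ij + b_i Ψ z_j + c_i (Ψ z_i)(Ψ z_j)`. -/
theorem hasMeixnerCoefficients {b c : Fin n → ℝ} {φ ψ : NCPoly n →ₗ[ℝ] ℝ}
    (hψ : IsSemicircularSeries b c (genSeries ψ))
    (hφ : HasFreeCumulants φ (expSum fun _ => ψ)) :
    HasMeixnerCoefficients φ (fun i j t => if j = t then b i else 0) fun i _ => c i := by
  refine ⟨_, hφ, fun i j => ?_⟩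
  rw [Finset.sum_eq_single j (fun t _ ht => by simp [ht.symm]) (by simp)]
  simp only [D_expSum, if_true]
  rw [D_mul, hψ.1, hψ.2, D_z]
  have : (if i = j then (1 : NCSeries n ℝ) else 0) = const (if i = j then 1 else 0) := by
    split_ifs <;> simp
  simp only [this, const_one, one_mul, add_mul, mul_assoc, add_assoc]

/-! ### Free Sheffer polynomials -/

/-- The series `1 + ∑ b_i z_i + ∑ c_i z_i²`. -/
noncomputable def quadratic (b c : Fin n → ℝ) : NCSeries n ℝ :=
  1 + ∑ i, (const (b i) * z i + const (c i) * (z i * z i))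

theorem quadratic_nil (b c : Fin n → ℝ) : quadratic b c [] = 1 := by
  simp [quadratic, NCSeries.add_apply, NCSeries.sum_apply, NCSeries.mul_nil]

theorem D_quadratic (b c : Fin n → ℝ) (i : Fin n) :
    D i (quadratic b c) = const (b i) + const (c i) * z i := by
  have : ∀ j, D i (const (b j) * z j + const (c j) * (z j * z j)) =
      if i = j then const (b j) + const (c j) * z j else 0 := fun j => by
    rw [D_add, D_const_mul, D_const_mul, D_z_mul, D_z]
    split_ifs <;> simp
  simp [quadratic, this]

section Inverse

variable {b c : Fin n → ℝ} {Q : NCSeries n ℝ} (hFQ : quadratic b c * Q = 1)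
  (hQF : Q * quadratic b c = 1)
include hFQ hQF

/-- Both sides solve `K = 1 + ∑ U_i (b_i K + c_i K U_i K)` with `U_i = Q z_i`. The lack of constant
terms in the `U_i` makes the solution unique. -/
theorem subst_semicircularSeries {Ψ : NCSeries n ℝ} (hΨ : IsSemicircularSeries b c Ψ) :
    subst Ψ (fun i => Q * z i) = quadratic b c := by
  set F := quadratic b c with hF
  have hV : ∀ i, (Q * z i : NCSeries n ℝ) [] = 0 := mul_z_nil Q
  -- Since `F Q = 1`, the sum collapses to `Q (F - 1) F = F - 1`.
  have hfix : F = 1 + ∑ i, Q * z i * (const (b i) * F + const (c i) * (F * (Q * z i * F))) := by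
    have : ∀ i, Q * z i * (const (b i) * F + const (c i) * (F * (Q * z i * F))) =
        Q * ((const (b i) * z i + const (c i) * (z i * z i)) * F) := fun i => by
      rw [mul_assoc Q (z i) F, ← mul_assoc F Q, hFQ, one_mul]
      simp only [mul_add, add_mul, mul_const_mul, mul_assoc]
    rw [Finset.sum_congr rfl fun i _ => this i, ← Finset.mul_sum, ← Finset.sum_mul,
      ← add_sub_cancel_left 1 (∑ i, (const (b i) * z i + const (c i) * (z i * z i))),
      ← quadratic, ← hF, sub_mul, one_mul, mul_sub, ← mul_assoc, hQF, one_mul]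
    abel
  refine eq_of_D_eq (Φ := fun j K => ∑ i, D j (Q * z i) *
    (const (b i) * K + const (c i) * (K * (Q * z i * K)))) (fun i k f g h => ?_) ?_
    (fun j => ?_) fun j => ?_
  · exact .sum _ fun i _ => (AgreeBelow.refl _ _).mul (((AgreeBelow.refl _ _).mul h).add
      ((AgreeBelow.refl _ _).mul (h.mul ((AgreeBelow.refl _ _).mul h))))
  · exact (subst_nil _ _).trans (hΨ.1.trans (quadratic_nil b c).symm)
  · conv_lhs => rw [subst_eq hV]
    simp only [D_add, D_const, D_sum, D_mul _ (Q * z _), hV, const_zero, zero_mul, zero_add,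
      hΨ.2, subst_add, subst_mul hV, subst_const hV, subst_z hV]
  · conv_lhs => rw [hfix]
    simp only [D_add, D_one, D_sum, D_mul _ (Q * z _), hV, const_zero, zero_mul, zero_add]

theorem isGradientInverse_expSum {ψ : NCPoly n →ₗ[ℝ] ℝ}
    (hψ : IsSemicircularSeries b c (genSeries ψ)) :
    IsGradientInverse (genSeries (expSum fun _ => ψ)) fun i => Q * z i := by
  refine ⟨mul_z_nil Q, fun i j => ?_, fun i => ?_⟩
  · have hQ : Q [] = 1 := by simpa [NCSeries.mul_nil, quadratic_nil] using congrFun hFQ []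
    exact (mul_z_append Q i j []).trans (by rw [hQ])
  · rw [D_expSum, subst_mul (mul_z_nil Q), subst_z (mul_z_nil Q),
      subst_semicircularSeries hFQ hQF hψ, ← mul_assoc, hFQ, one_mul]

theorem isFreeSheffer_poly {ψ : NCPoly n →ₗ[ℝ] ℝ}
    (hψ : IsSemicircularSeries b c (genSeries ψ)) :
    IsFreeSheffer (genSeries (expSum fun _ => ψ)) (fun i => Q * z i)
      (Fock.poly (twoLevel 0 b) (twoLevel (fun _ => 1) fun i => 1 + c i)) := by
  unfold IsFreeSheffer
  intro G H
  have hsub : subst (genSeries (expSum fun _ => ψ)) (fun i => Q * z i) =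
      ∑ i, Q * z i * z i := by
    have h₀ : genSeries (expSum fun _ => ψ) [] = 0 := expSum_one _
    rw [subst_eq (mul_z_nil Q), h₀, const_zero, zero_add]
    simp only [(isGradientInverse_expSum hFQ hQF hψ).2.2]
  have hH₀ : H [] = 1 := rfl
  -- The three-term recursion for `poly` in series form. The last term, `b_i + c_i z_i`, corrects
  -- for the different coefficients `0` and `1` at the vacuum.
  have hH : ∀ i, D i H = const (x i - algebraMap ℝ _ (b i)) * H -
      const (1 + algebraMap ℝ _ (c i)) * (z i * H) + (D i (quadratic b c)).toPoly := by
    intro i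
    rw [D_quadratic]
    ext w
    simp only [NCSeries.add_apply, NCSeries.sub_apply, const_mul_apply, toPoly_add, toPoly_const,
      toPoly_mul, toPoly_z]
    match w with
    | [] =>
      rw [z_mul_nil]
      simp [H, D, Fock.poly, twoLevel]
    | [j] =>
      rw [z_mul_cons]
      by_cases h : i = j
      · simp [H, D, Fock.poly, twoLevel, z, const, h]
        abel
      · simp [H, D, Fock.poly, twoLevel, z, const, h, eq_comm (a := j)]
    | j :: k :: v =>
      rw [z_mul_cons]
      by_cases h : i = j <;>
        simp [H, D, Fock.poly, twoLevel, z, const, h, Algebra.smul_def, add_mul]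
  -- Because `R(U) = ∑ Q z_i z_i` and `Q F = 1`, the Sheffer denominator factors as `G = Q W`. Then
  -- `W H = F` yields `G H = Q F = 1`.
  let W : NCSeries n (NCPoly n) :=
    (quadratic b c).toPoly - ∑ i, const (x i) * z i + ∑ i, z i * z i
  have hWH : W * H = (quadratic b c).toPoly := by
    have hW₀ : W [] = 1 := by
      simp [W, NCSeries.add_apply, NCSeries.sub_apply, NCSeries.sum_apply, NCSeries.mul_nil,
        quadratic_nil]
    refine ext_D ?_ fun i => ?_
    · simp [NCSeries.mul_nil, hW₀, hH₀, quadratic_nil]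
    · have hDW : D i W = (D i (quadratic b c)).toPoly - const (x i) + z i := by
        simp [W, D_z_mul]
      have hx : (const (x i - algebraMap ℝ _ (b i)) : NCSeries n (NCPoly n)) =
          const (x i) - const (algebraMap ℝ _ (b i)) := by
        rw [eq_sub_iff_add_eq, ← const_add, sub_add_cancel]
      rw [D_mul, hW₀, hDW, const_one, one_mul, hH, D_toPoly, hx, D_quadratic]
      simp only [toPoly_add, toPoly_const, toPoly_mul, toPoly_z, const_add, const_one, add_mul,
        sub_mul, one_mul, mul_assoc]
      abel
  have hG : G = Q.toPoly * W := by
    have h₁ : Q.toPoly * (quadratic b c).toPoly = 1 := by rw [← toPoly_mul, hQF, toPoly_one]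
    have h₂ : ∀ i, const (x i) * (Q * z i).toPoly = Q.toPoly * (const (x i) * z i) := fun i => by
      rw [toPoly_mul, ← mul_assoc, ← toPoly_mul_const, mul_assoc, toPoly_z]
    simp only [G, hsub, h₂, W, mul_add, mul_sub, h₁, Finset.mul_sum]
    simp only [toPoly_sum, toPoly_mul, toPoly_z, mul_assoc]
  have hGH : G * H = 1 := by rw [hG, mul_assoc, hWH, ← toPoly_mul, hQF, toPoly_one]
  have hG₀ : G [] = 1 := by simpa [NCSeries.mul_nil, hH₀] using congrFun hGH []
  obtain ⟨g, -, -, hgG⟩ := exists_mul_eq_one hG₀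
  have : g = H := by rw [← mul_one g, ← hGH, ← mul_assoc, hgG, one_mul]
  exact ⟨hGH, this ▸ hgG⟩

end Inverse

theorem meixner_isFreeMeixner {b c : Fin n → ℝ} (hc : ∀ i, 0 ≤ c i) {ψ : NCPoly n →ₗ[ℝ] ℝ}
    (hψ : IsSemicircularSeries b c (genSeries ψ)) : IsFreeMeixner (meixner b c 1) := by
  obtain ⟨Q, -, hFQ, hQF⟩ := exists_mul_eq_one (quadratic_nil b c)
  exact ⟨meixner_isState hc zero_le_one, meixner_isNormalized b c, _, _, _,
    one_smul ℝ (expSum fun _ => ψ) ▸ hasFreeCumulants_meixner hψ 1,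
    isGradientInverse_expSum hFQ hQF hψ, isFreeSheffer_poly hFQ hQF hψ,
    fun _ _ h => Fock.vacuum_star_poly_mul_poly _ _ h⟩

end NCPoly

theorem mainTheorem5 (n : ℕ) (b c : Fin n → ℝ) (hc : ∀ i, 0 ≤ c i) :
    (∃! ψ : NCPoly n →ₗ[ℝ] ℝ, NCPoly.IsFreeSemicircularLaw b c ψ) ∧
    ∀ ψ : NCPoly n →ₗ[ℝ] ℝ, NCPoly.IsFreeSemicircularLaw b c ψ →
      (∃! φ : NCPoly n →ₗ[ℝ] ℝ,
        φ 1 = 1 ∧ NCPoly.HasFreeCumulants φ (NCPoly.expSum fun _ : Fin n => ψ)) ∧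
      ∀ φ : NCPoly n →ₗ[ℝ] ℝ,
        φ 1 = 1 → NCPoly.HasFreeCumulants φ (NCPoly.expSum fun _ : Fin n => ψ) →
          NCPoly.IsState φ ∧
          NCPoly.IsFaithful φ ∧
          NCPoly.IsFreelyInfinitelyDivisible φ ∧
          NCPoly.IsFreeMeixner φ ∧
          NCPoly.HasMeixnerCoefficients φ (fun i j t => if j = t then b i else 0)
            (fun i _ => c i) ∧
          (2 ≤ n → (∃ i, c i ≠ 0) → ¬ NCPoly.IsTracial φ) := by
  refine ⟨?_, fun ψ hψ => ?_⟩
  · obtain ⟨ψ, hψ⟩ := NCPoly.exists_isFreeSemicircularLaw b c hc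
    exact ⟨ψ, hψ, fun ψ' hψ' => NCPoly.HasFreeCumulants.unique hψ'.1.1 hψ.1.1 hψ'.2 hψ.2⟩
  have hser := (NCPoly.hasFreeCumulants_semicircular_iff hψ.1.1).1 hψ.2
  have hR : NCPoly.HasFreeCumulants (NCPoly.meixner b c 1) (NCPoly.expSum fun _ => ψ) :=
    one_smul ℝ (NCPoly.expSum fun _ => ψ) ▸ NCPoly.hasFreeCumulants_meixner hser 1
  have h₁ := NCPoly.meixner_isState (b := b) hc zero_le_one
  refine ⟨⟨_, ⟨h₁.1, hR⟩, fun φ hφ => NCPoly.HasFreeCumulants.unique hφ.1 h₁.1 hφ.2 hR⟩, fun φ hφ₁ hφ => ?_⟩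
  obtain rfl : φ = NCPoly.meixner b c 1 := NCPoly.HasFreeCumulants.unique hφ₁ h₁.1 hφ hR
  exact ⟨h₁, NCPoly.meixner_isFaithful hc one_pos,
    ⟨h₁, _, hR, fun t ht => ⟨_, NCPoly.meixner_isState hc ht.le,
      NCPoly.hasFreeCumulants_meixner hser t⟩⟩,
    NCPoly.meixner_isFreeMeixner hc hser, NCPoly.hasMeixnerCoefficients hser hR,
    NCPoly.meixner_not_isTracial hc⟩
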